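/- Let $\alpha\ge 1$ be an integer. For $d\ge 1$ let $\rho$ be the standard Gaussian density on $\mathbb{R}^d$, $I(f)=\int_{\mathbb{R}^d} f\rho\,\mathrm{d}x$, and let $H^\alpha_\rho(\mathbb{R}^d)$ be the space of functions whose weak derivatives $D^{r}f$ with $|r|_\infty\le\alpha$ all lie in $L^2_\rho(\mathbb{R}^d)$, with norm $\|f\|_{H^\alpha_\rho}=\big(\sum_{|r|_\infty\le\alpha}\|D^{r}f\|_{L^2_\rho}^2\big)^{1/2}$; its elements are identified with their continuous representatives. Given integers $n_\ell\ge 1$ ($\ell\ge 1$) and real weights $w_{\ell,\xi}$, put $Q_0=0$ and $Q_\ell(g)=\sum_{\xi} w_{\ell,\xi}\,g(\xi)$ for $\ell\ge1$, the sum being over the zeros $\xi$ of the Hermite polynomial (orthogonal for the standard Gaussian weight) of degree $n_\ell$. Let $\Delta_\ell=Q_\ell-Q_{\ell-1}$ for $\ell\ge1$, and for a finite set $\Lambda\subset\mathbb{N}^d$, $\mathbb{N}=\{1,2,\dots\}$, let $$S_\Lambda^{w}=\sum_{\ell\in\Lambda}\Delta_{\ell_1}\otimes\cdots\otimes\Delta_{\ell_d}.$$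 Let $S_\Lambda$ be the case of the Gauss–Hermite weights, i.e. $w_{\ell,\xi}$ is the Gaussian integral of the Lagrange basis polynomial of $\xi$ for the zeros of the Hermite polynomial of degree $n_\ell$. Let the sparse grid $G_\Lambda$ be the union over $\ell\in\Lambda$ of the product sets $X_{\ell_1}\times\cdots\times X_{\ell_d}$, where $X_\ell$ is the set of nodes of $Q_\ell$ and $Q_{\ell-1}$. Call $\Lambda$ downward-closed in one direction if for some $j\in\{1,\dots,d\}$, whenever $(1,\dots,1,\ell,1,\dots,1)\in\Lambda$ with $\ell$ in position $j$, also $(1,\dots,1,k,1,\dots,1)\in\Lambda$ for all $1\le k\le\ell$. **Theorem.** There is a constant $c_\alpha>0$ depending only on $\alpha$ such that for all $d\ge1$, all $(n_\ell)_{\ell\ge1}$ and every finite $\Lambda\subset\mathbb{N}^d$ that is downward-closed in one direction: 1. If $S_\Lambda$ uses $N\ge1$ point evaluations, i.e. $S_\Lambda(f)=\sum_{i=1}^N w_i f(x_i)$ for some points $x_i\in\mathbb{R}^d$ and real $w_i$, then $$\sup_{f\neq0}\frac{|I(f)-S_\Lambda(f)|}{\|f\|_{H^\alpha_\rho}}\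 \ge\ c_\alpha N^{-\alpha/2}.$$ 2. If $\Lambda\ne\emptyset$, there is a nonzero $h\in H^\alpha_\rho(\mathbb{R}^d)$ that depends on a single coordinate only and not on the weights, such that $$\frac{|I(h)-S^{w}_\Lambda(h)|}{\|h\|_{H^\alpha_\rho}}\ \ge\ c_\alpha (\#G_\Lambda)^{-\alpha/2}$$ for all weights $w$ for which $\sum_\xi w_{\ell,\xi}=1$ for every $\ell\ge1$ (each $Q_\ell$ is exact for constants); if $d=1$, for all weights $w$ whatsoever. -/

import Mathlib

open MeasureTheory ProbabilityTheory

noncomputable section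

namespace GaussHermite

/-! ### The Gaussian Sobolev space of dominating mixed smoothness -/

/-- The standard Gaussian measure on `ℝ^d`, with Lebesgue density `exp (-|x|² / 2) / (2π)^(d/2)`. -/
def gaussian (d : ℕ) : Measure (Fin d → ℝ) :=
  Measure.pi fun _ => gaussianReal 0 1

/-- The classical partial derivative `∂φ/∂x_j`. -/
def pderiv {d : ℕ} (j : Fin d) (φ : (Fin d → ℝ) → ℝ) : (Fin d → ℝ) → ℝ :=
  fun x => fderiv ℝ φ x (Pi.single j 1)

/-- The classical mixed derivative `D^r φ = ∂_1^{r_1} ⋯ ∂_d^{r_d} φ` (used for smooth `φ` only). -/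
def mderiv {d : ℕ} (r : Fin d → ℕ) (φ : (Fin d → ℝ) → ℝ) : (Fin d → ℝ) → ℝ :=
  (List.finRange d).foldr (fun j ψ => (pderiv j)^[r j] ψ) φ

/-- `g` is a weak derivative `D^r f` of `f` on `ℝ^d`. -/
def IsWeakDeriv {d : ℕ} (r : Fin d → ℕ) (f g : (Fin d → ℝ) → ℝ) : Prop :=
  LocallyIntegrable f volume ∧ LocallyIntegrable g volume ∧
    ∀ φ : (Fin d → ℝ) → ℝ, ContDiff ℝ (⊤ : ℕ∞) φ → HasCompactSupport φ →
      ∫ x, f x * mderiv r φ x = (-1 : ℝ) ^ (∑ j, r j) * ∫ x, g x * φ x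

open scoped Classical in
/-- The weak derivative `D^r f` (unique up to null sets); the zero function if there is none. -/
def weakDeriv {d : ℕ} (r : Fin d → ℕ) (f : (Fin d → ℝ) → ℝ) : (Fin d → ℝ) → ℝ :=
  if h : ∃ g, IsWeakDeriv r f g then h.choose else 0

/-- `f` is (the continuous representative of) an element of `H_ρ^α(ℝ^d)`: all weak derivatives
`D^r f` with `max_j r_j ≤ α` exist and are square integrable for the Gaussian measure.
For `α ≥ 1` every element of the space has exactly one continuous representative, and point
evaluations refer to it. -/
def MemSobolev {d : ℕ} (α : ℕ) (f : (Fin d → ℝ) → ℝ) : Prop :=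
  Continuous f ∧ ∀ r : Fin d → ℕ, (∀ j, r j ≤ α) →
    ∃ g, IsWeakDeriv r f g ∧ MemLp g 2 (gaussian d)

/-- The norm `(∑_{|r|_∞ ≤ α} ‖D^r f‖²)^{1/2}`, with Gaussian weighted `L²` norms. -/
def sobolevNorm {d : ℕ} (α : ℕ) (f : (Fin d → ℝ) → ℝ) : ℝ :=
  Real.sqrt (∑ r : Fin d → Fin (α + 1),
    ∫ x, (weakDeriv (fun j => (r j : ℕ)) f x) ^ 2 ∂(gaussian d))

/-- The integral `I(f)` of `f` against the standard Gaussian measure. -/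
def gaussInt {d : ℕ} (f : (Fin d → ℝ) → ℝ) : ℝ :=
  ∫ x, f x ∂(gaussian d)

/-- The worst-case error `sup_{f ≠ 0} |I(f) - S(f)| / ‖f‖` over `H_ρ^α(ℝ^d)`, in `[0, ∞]`. -/
def worstCaseError {d : ℕ} (α : ℕ) (S : ((Fin d → ℝ) → ℝ) → ℝ) : ENNReal :=
  ⨆ f : {f : (Fin d → ℝ) → ℝ // MemSobolev α f ∧ f ≠ 0},
    ENNReal.ofReal (|gaussInt f.1 - S f.1| / sobolevNorm α f.1)

/-! ### Univariate rules on Gauss–Hermite nodes -/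

/-- The `m` Gauss–Hermite nodes: the real zeros of the Hermite polynomial of degree `m`. -/
def nodes (m : ℕ) : Finset ℝ :=
  ((Polynomial.hermite m).aroots ℝ).toFinset

/-- The Gauss–Hermite weight at the node `ξ`: the Gaussian integral of the Lagrange basis
polynomial of `ξ`. -/
def ghWeight (m : ℕ) (ξ : ℝ) : ℝ :=
  ∫ x, (Lagrange.basis (nodes m) id ξ).eval x ∂(gaussianReal 0 1)

/-- The univariate rule of level `ℓ`, as a formal linear combination of point evaluations: it has
the `n ℓ` Gauss–Hermite nodes, with weights `W ℓ ξ`. The rule of level `0` is zero. -/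
def uniRule (n : ℕ → ℕ) (W : ℕ → ℝ → ℝ) (ℓ : ℕ) : ℝ →₀ ℝ :=
  if ℓ = 0 then 0 else ∑ ξ ∈ nodes (n ℓ), Finsupp.single ξ (W ℓ ξ)

/-- The differences `Δ_0 = 0` and `Δ_ℓ = Q_ℓ - Q_{ℓ-1}` for `ℓ ≥ 1`. -/
def diffRule (n : ℕ → ℕ) (W : ℕ → ℝ → ℝ) (ℓ : ℕ) : ℝ →₀ ℝ :=
  if ℓ = 0 then 0 else uniRule n W ℓ - uniRule n W (ℓ - 1)

/-! ### Sparse grids -/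

/-- The tensor product `R_1 ⊗ ⋯ ⊗ R_d` of univariate rules, as a functional of `f`. -/
def tensorRule {d : ℕ} (R : Fin d → (ℝ →₀ ℝ)) (f : (Fin d → ℝ) → ℝ) : ℝ :=
  ∑ x ∈ Fintype.piFinset (fun j => (R j).support), (∏ j, R j (x j)) * f x

/-- The sparse-grid quadrature `S_Λ = ∑_{ℓ ∈ Λ} Δ_{ℓ_1} ⊗ ⋯ ⊗ Δ_{ℓ_d}` with Gauss–Hermite nodes and
univariate weights `W`. -/
def sparseQuad {d : ℕ} (n : ℕ → ℕ) (W : ℕ → ℝ → ℝ) (Λ : Finset (Fin d → ℕ))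
    (f : (Fin d → ℝ) → ℝ) : ℝ :=
  ∑ ℓ ∈ Λ, tensorRule (fun j => diffRule n W (ℓ j)) f

/-- The sparse-grid quadrature based on the Gauss–Hermite rules with `n ℓ` points at level `ℓ`. -/
def sparseGH {d : ℕ} (n : ℕ → ℕ) (Λ : Finset (Fin d → ℕ)) (f : (Fin d → ℝ) → ℝ) : ℝ :=
  sparseQuad n (fun ℓ ξ => ghWeight (n ℓ) ξ) Λ f

/-- The functional `S` is a quadrature rule using `N` point evaluations. Repeated points and zero
weights are allowed, so that this holds for every way of counting the evaluations, including the
most economical one, in which coinciding points are merged and cancelling ones are dropped. -/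
def IsRuleWithPoints {d : ℕ} (S : ((Fin d → ℝ) → ℝ) → ℝ) (N : ℕ) : Prop :=
  ∃ (x : Fin N → Fin d → ℝ) (w : Fin N → ℝ), ∀ f : (Fin d → ℝ) → ℝ, S f = ∑ i, w i * f (x i)

/-- The nodes of `Δ_ℓ`: those of levels `ℓ` and `ℓ - 1`, with no node at level `0`. -/
def diffNodes (n : ℕ → ℕ) (ℓ : ℕ) : Finset ℝ :=
  (if ℓ = 0 then ∅ else nodes (n ℓ)) ∪ (if ℓ - 1 = 0 then ∅ else nodes (n (ℓ - 1)))

/-- The sparse grid: the set of all nodes of the tensor products `Δ_{ℓ_1} ⊗ ⋯ ⊗ Δ_{ℓ_d}`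
with `ℓ ∈ Λ`. It does not depend on the weights. -/
def sparseGrid {d : ℕ} (n : ℕ → ℕ) (Λ : Finset (Fin d → ℕ)) : Finset (Fin d → ℝ) :=
  Λ.biUnion fun ℓ => Fintype.piFinset fun j => diffNodes n (ℓ j)

/-- For some coordinate `j`: if `(1, …, 1, ℓ, 1, …, 1) ∈ Λ`, with `ℓ` in position `j`, then
`(1, …, 1, k, 1, …, 1) ∈ Λ` for all `1 ≤ k ≤ ℓ`. -/
def DownwardClosedInOneDirection {d : ℕ} (Λ : Finset (Fin d → ℕ)) : Prop :=
  ∃ j : Fin d, ∀ ℓ : ℕ, Function.update (1 : Fin d → ℕ) j ℓ ∈ Λ →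
    ∀ k : ℕ, 1 ≤ k → k ≤ ℓ → Function.update (1 : Fin d → ℕ) j k ∈ Λ

end GaussHermite

end

open GaussHermite

open MeasureTheory ProbabilityTheory
open scoped ContDiff

namespace GaussHermite

/-! The error is already large on functions `x ↦ p (x_j)` of a single coordinate. If every `Q_ℓ` is
exact for constants, then `Δ_1` maps `1` to `1` and the later differences map it to `0`. So only the
indices `(1, …, k, …, 1)` act on such a function; by downward closedness their `k` fill an interval
`1, …, L`, and the sum telescopes to `Q_L p` (`sparseQuad_coord`). It remains to fool one univariate
rule with `n = n_L` nodes, at a cost independent of `d`.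

The Hermite function `u = H_n e^{-x²/4}` solves `u'' = -(n + 1/2 - x²/4) u`, which forces its zeros
in `[0, 1]` to be at least of order `n^{-1/2}` apart (`nodes_spacing`). With `m ≈ √n`, a grid of
`2m` cells in `[0, 1]` therefore has at least `m` cells without nodes inside. Bumps in these cells
add up to a function that vanishes at all nodes, has mean bounded below and norm at most a multiple
of `m^α` (`exists_fooling_profile`). The error is then at least of order `n^{-α/2}`, whatever the
weights.

Finally `n_L` is compared with the cost. The sparse grid contains a box having the nodes of `Q_L`
along direction `j`; and since Gauss–Hermite weights are positive, no representation of `S_Λ` by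
point evaluations can avoid any of these nodes as a `j`-th coordinate
(`levelSize_le_of_isRuleWithPoints`). If `L = 0`, the constant `1` is the fooling function. -/

open Polynomial in
/-- The Hermite polynomial with real coefficients. -/
noncomputable def realHermite (n : ℕ) : Polynomial ℝ := (Polynomial.hermite n).map (algebraMap ℤ ℝ)

/-! ### Recurrences and differential equation of the Hermite polynomials. -/

open Polynomial in
theorem realHermite_succ (n : ℕ) :
    realHermite (n + 1) = X * realHermite n - derivative (realHermite n) := by
  simp [realHermite, hermite_succ, derivative_map]

open Polynomial in
theorem derivative_realHermite_succ (n : ℕ) :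
    derivative (realHermite (n + 1)) = ((n + 1 : ℕ) : ℝ[X]) * realHermite n := by
  induction n with
  | zero => simp [realHermite]
  | succ n ih =>
    rw [realHermite_succ (n + 1), derivative_sub, derivative_mul, derivative_X, ih,
      derivative_mul, realHermite_succ n]
    simp
    ring

-- Differentiating `H_{n+1} = x H_n - H_n'` and comparing with `H_{n+1}' = (n + 1) H_n` gives the
-- Hermite equation, the input for the spacing of the zeros.
open Polynomial in
theorem derivative_derivative_realHermite (n : ℕ) :
    derivative (derivative (realHermite n)) =
      X * derivative (realHermite n) - (n : ℝ[X]) * realHermite n := by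
  have h := derivative_realHermite_succ n
  rw [realHermite_succ, derivative_sub, derivative_mul, derivative_X] at h
  push_cast at h
  linear_combination -h

theorem natDegree_realHermite (n : ℕ) : (realHermite n).natDegree = n := by
  rw [realHermite, (Polynomial.hermite_monic n).natDegree_map, Polynomial.natDegree_hermite]

theorem realHermite_monic (n : ℕ) : (realHermite n).Monic :=
  (Polynomial.hermite_monic n).map _

theorem nodes_eq (n : ℕ) : nodes n = (realHermite n).roots.toFinset := rfl

theorem mem_nodes {n : ℕ} {x : ℝ} : x ∈ nodes n ↔ (realHermite n).eval x = 0 := by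
  rw [nodes_eq, Multiset.mem_toFinset, Polynomial.mem_roots (realHermite_monic n).ne_zero]
  rfl

/-! ### Gaussian integrals of polynomials -/

theorem integrable_eval_gaussianReal (p : Polynomial ℝ) :
    Integrable (fun x => p.eval x) (gaussianReal 0 1) := by
  induction p using Polynomial.induction_on' with
  | add p q hp hq =>
    simp only [Polynomial.eval_add]
    exact hp.add hq
  | monomial k a =>
    simp only [Polynomial.eval_monomial]
    refine Integrable.const_mul ?_ a
    have h := (memLp_id_gaussianReal (μ := 0) (v := 1) k).integrable_norm_pow'
    refine (integrable_norm_iff (by fun_prop)).1 (h.congr ?_)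
    filter_upwards with x
    simp

theorem integrable_gaussianPDFReal_mul_eval (p : Polynomial ℝ) :
    Integrable (fun x => gaussianPDFReal 0 1 x * p.eval x) := by
  have h := integrable_eval_gaussianReal p
  rw [gaussianReal_of_var_ne_zero 0 one_ne_zero, integrable_withDensity_iff_integrable_smul'
    (measurable_gaussianPDF _ _) (ae_of_all _ fun _ => gaussianPDF_lt_top)] at h
  simpa [gaussianPDF, gaussianPDFReal_nonneg] using h

theorem hasDerivAt_gaussianPDFReal (x : ℝ) :
    HasDerivAt (gaussianPDFReal 0 1) (-x * gaussianPDFReal 0 1 x) x := by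
  have h : HasDerivAt (fun x : ℝ => -(x - 0) ^ 2 / (2 * ((1 : NNReal) : ℝ))) (-x) x := by
    have := (((hasDerivAt_id x).sub_const 0).pow 2).neg.div_const (2 * ((1 : NNReal) : ℝ))
    convert! this using 1
    simp
    ring
  have := h.exp.const_mul (√(2 * Real.pi * ((1 : NNReal) : ℝ)))⁻¹
  convert! this using 1
  simp only [gaussianPDFReal]
  ring

-- Gaussian integration by parts: `ρ p` has derivative `ρ (p' - x p)`, and both are integrable.
open Polynomial in
theorem integral_eval_X_mul (p : ℝ[X]) :
    ∫ x, (X * p).eval x ∂(gaussianReal 0 1) = ∫ x, (derivative p).eval x ∂(gaussianReal 0 1) := by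
  rw [← sub_eq_zero, ← integral_sub (integrable_eval_gaussianReal _)
    (integrable_eval_gaussianReal _), ← neg_eq_zero, ← integral_neg,
    integral_gaussianReal_eq_integral_smul one_ne_zero]
  refine integral_eq_zero_of_hasDerivAt_of_integrable
    (f := fun x => gaussianPDFReal 0 1 x * p.eval x) (fun x => ?_) ?_
    (integrable_gaussianPDFReal_mul_eval p)
  · convert! (hasDerivAt_gaussianPDFReal x).mul (p.hasDerivAt x) using 1
    simp
    ring
  · refine (integrable_gaussianPDFReal_mul_eval (derivative p - X * p)).congr (ae_of_all _ fun x => ?_)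
    simp

/-- Integration by parts trades `H_{n+1} = x H_n - H_n'` against `q` for `H_n` against `q'`; the
degree of `q` runs out before the index does. -/
theorem integral_realHermite_mul_of_natDegree_lt {n : ℕ} {q : Polynomial ℝ}
    (hq : q.natDegree < n) :
    ∫ x, (realHermite n * q).eval x ∂(gaussianReal 0 1) = 0 := by
  induction n generalizing q with
  | zero => omega
  | succ n ih =>
    have h1 : ∫ x, (realHermite (n + 1) * q).eval x ∂(gaussianReal 0 1) =
        ∫ x, (realHermite n * Polynomial.derivative q).eval x ∂(gaussianReal 0 1) := by
      have h2 := integral_eval_X_mul (realHermite n * q)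
      rw [← sub_eq_zero, ← integral_sub (integrable_eval_gaussianReal _)
        (integrable_eval_gaussianReal _)] at h2 ⊢
      rw [← h2]
      congr with x
      rw [realHermite_succ, Polynomial.derivative_mul]
      simp
      ring
    rw [h1]
    by_cases hd : q.natDegree = 0
    · rw [Polynomial.derivative_of_natDegree_zero hd]
      simp
    · exact ih ((Polynomial.natDegree_derivative_lt hd).trans_le (by omega))

/-- A polynomial that is nonnegative on the line and has Gaussian mean zero vanishes. -/
theorem eq_zero_of_integral_eval_eq_zero {p : Polynomial ℝ} (h0 : ∀ x, 0 ≤ p.eval x)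
    (hi : ∫ x, p.eval x ∂(gaussianReal 0 1) = 0) : p = 0 := by
  have h1 := (integral_eq_zero_iff_of_nonneg h0 (integrable_eval_gaussianReal p)).1 hi
  have h2 : (fun x => p.eval x) =ᵐ[volume] 0 :=
    (gaussianReal_absolutelyContinuous' 0 one_ne_zero).ae_eq h1
  have h3 := (Continuous.ae_eq_iff_eq volume p.continuous continuous_zero).1 h2
  exact Polynomial.funext fun x => by simpa using congrFun h3 x

/-! ### Simplicity of the Gauss–Hermite nodes -/

open Polynomial in
/-- A real polynomial changes sign at most at its roots of odd multiplicity. -/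
theorem exists_prod_mul_constant_sign (p : ℝ[X]) (hp : p ≠ 0) :
    ∃ Z ⊆ p.roots.toFinset, (∀ x, 0 ≤ (p * ∏ z ∈ Z, (X - C z)).eval x) ∨
      ∀ x, (p * ∏ z ∈ Z, (X - C z)).eval x ≤ 0 := by
  classical
  obtain ⟨q, hq, -, hr⟩ := Polynomial.exists_prod_multiset_X_sub_C_mul p
  have hq0 : q ≠ 0 := by rintro rfl; simp at hq; exact hp hq.symm
  have hne : ∀ x, q.eval x ≠ 0 := fun x hx => by
    have : x ∈ q.roots := (mem_roots hq0).2 hx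
    simp [hr] at this
  -- One extra factor at each root of odd multiplicity makes all exponents even, leaving only the
  -- sign of the rootless cofactor `q`.
  refine ⟨p.roots.toFinset.filter fun z => Odd (p.roots.count z), Finset.filter_subset _ _, ?_⟩
  have key : ∀ x, ∃ s, 0 ≤ s ∧ (p * ∏ z ∈ p.roots.toFinset.filter
      (fun z => Odd (p.roots.count z)), (X - C z)).eval x = s * q.eval x := fun x => by
    refine ⟨∏ z ∈ p.roots.toFinset, (x - z) ^ (p.roots.count z +
      if Odd (p.roots.count z) then 1 else 0), Finset.prod_nonneg fun z _ => ?_, ?_⟩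
    · refine Even.pow_nonneg ?_ _
      split_ifs with h
      · exact h.add_one
      · simpa using h
    · rw [Finset.prod_filter]
      rw [Finset.prod_multiset_map_count] at hq
      generalize p.roots = R at hq ⊢
      rw [← hq]
      simp only [eval_mul, eval_prod, eval_pow, eval_sub, eval_X, eval_C, pow_add,
        Finset.prod_mul_distrib]
      rw [mul_right_comm]
      congr 2
      refine Finset.prod_congr rfl fun z _ => ?_
      split_ifs <;> simp
  have hsign : (∀ x, 0 < q.eval x) ∨ ∀ x, q.eval x < 0 := by
    by_contra! h
    obtain ⟨⟨x, hx⟩, y, hy⟩ := h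
    obtain ⟨z, hz⟩ := mem_range_of_exists_le_of_exists_ge q.continuous ⟨x, hx⟩ ⟨y, hy⟩
    exact hne z hz
  refine hsign.imp (fun h x => ?_) fun h x => ?_
  · obtain ⟨s, hs, e⟩ := key x
    exact e ▸ mul_nonneg hs (h x).le
  · obtain ⟨s, hs, e⟩ := key x
    exact e ▸ mul_nonpos_of_nonneg_of_nonpos hs (h x).le

/-- With fewer than `n` distinct real zeros, multiplying `H_n` by linear factors at its sign changes
would give a nonzero polynomial of constant sign. Orthogonality makes its Gaussian mean zero, a
contradiction. -/
theorem card_nodes (n : ℕ) : (nodes n).card = n := by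
  refine le_antisymm ?_ ?_
  · calc (nodes n).card ≤ (realHermite n).roots.card := Multiset.toFinset_card_le _
      _ ≤ (realHermite n).natDegree := Polynomial.card_roots' _
      _ = n := natDegree_realHermite n
  · by_contra! hlt
    obtain ⟨Z, hZ, hs⟩ := exists_prod_mul_constant_sign _ (realHermite_monic n).ne_zero
    have hmon : (∏ z ∈ Z, (Polynomial.X - Polynomial.C z)).Monic :=
      Polynomial.monic_prod_of_monic _ _ fun z _ => Polynomial.monic_X_sub_C z
    have hdeg : (∏ z ∈ Z, (Polynomial.X - Polynomial.C z)).natDegree < n := by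
      rw [Polynomial.natDegree_prod_of_monic _ _ fun z _ => Polynomial.monic_X_sub_C z]
      simpa using (Finset.card_le_card hZ).trans_lt hlt
    have hi := integral_realHermite_mul_of_natDegree_lt hdeg
    have hne := ((realHermite_monic n).mul hmon).ne_zero
    rcases hs with hs | hs
    · exact hne (eq_zero_of_integral_eval_eq_zero hs hi)
    · refine hne (neg_eq_zero.1 (eq_zero_of_integral_eval_eq_zero (fun x => ?_) ?_))
      · simpa using hs x
      · simpa [integral_neg] using hi

theorem nodes_nonempty {n : ℕ} (hn : 1 ≤ n) : (nodes n).Nonempty := by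
  rw [← Finset.card_pos, card_nodes]
  exact hn

theorem realHermite_eq_prod (n : ℕ) :
    realHermite n = ∏ ξ ∈ nodes n, (Polynomial.X - Polynomial.C ξ) := by
  classical
  have hc : (realHermite n).roots.card = (realHermite n).natDegree :=
    le_antisymm (Polynomial.card_roots' _) (by
      rw [natDegree_realHermite]
      refine (card_nodes n).symm.trans_le ?_
      exact Multiset.toFinset_card_le (realHermite n).roots)
  have hnd : (realHermite n).roots.Nodup := by
    rw [← Multiset.toFinset_card_eq_card_iff_nodup, hc, natDegree_realHermite]
    exact card_nodes n
  conv_lhs => rw [← Polynomial.prod_multiset_X_sub_C_of_monic_of_roots_card_eq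
    (realHermite_monic n) hc]
  rw [Finset.prod, nodes_eq, Multiset.toFinset_val, hnd.dedup]

/-! ### Gauss–Hermite weights -/

theorem sum_ghWeight {n : ℕ} (hn : 1 ≤ n) : ∑ ξ ∈ nodes n, ghWeight n ξ = 1 := by
  simp only [ghWeight]
  rw [← integral_finsetSum _ fun ξ _ => integrable_eval_gaussianReal _]
  simp only [← Polynomial.eval_finsetSum]
  rw [Lagrange.sum_basis (Function.injective_id.injOn) (nodes_nonempty hn)]
  simp

-- For the Lagrange basis polynomial `L`, `L² - L` vanishes at all nodes, so it is `H_n` times a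
-- polynomial of degree below `n` and has mean zero. Hence the weight equals `∫ L² > 0`.
open Polynomial in
theorem ghWeight_pos {n : ℕ} {ξ : ℝ} (hξ : ξ ∈ nodes n) : 0 < ghWeight n ξ := by
  set L := Lagrange.basis (nodes n) id ξ with hL
  have hinj : Set.InjOn id (nodes n : Set ℝ) := Function.injective_id.injOn
  have hn : 1 ≤ n := by
    rw [← card_nodes n]
    exact Finset.card_pos.2 ⟨ξ, hξ⟩
  have hLd : L.natDegree = n - 1 := by
    rw [Polynomial.natDegree_eq_of_degree_eq_some (Lagrange.degree_basis hinj hξ), card_nodes]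
  have hL1 : L.eval ξ = 1 := Lagrange.eval_basis_self (v := id) hinj hξ
  have hdvd : realHermite n ∣ L * L - L := by
    rw [realHermite_eq_prod]
    refine Finset.prod_dvd_of_coprime (fun a _ b _ hab =>
      pairwise_coprime_X_sub_C Function.injective_id hab) fun η hη => ?_
    rw [dvd_iff_isRoot, IsRoot, eval_sub, eval_mul]
    by_cases h : η = ξ
    · rw [h, hL1]
      norm_num
    · have : L.eval η = 0 := Lagrange.eval_basis_of_ne (v := id) (Ne.symm h) hη
      rw [this]
      norm_num
  obtain ⟨q, hq⟩ := hdvd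
  have hint : ∫ x, (L * L - L).eval x ∂(gaussianReal 0 1) = 0 := by
    by_cases hq0 : q = 0
    · simp [hq, hq0]
    rw [hq]
    refine integral_realHermite_mul_of_natDegree_lt ?_
    have h1 : (realHermite n * q).natDegree = n + q.natDegree := by
      rw [natDegree_mul (realHermite_monic n).ne_zero hq0, natDegree_realHermite]
    have h2 : (L * L - L).natDegree ≤ (n - 1) + (n - 1) :=
      (natDegree_sub_le _ _).trans (max_le (natDegree_mul_le.trans (by omega)) (by omega))
    rw [hq, h1] at h2
    omega
  have hsq : ghWeight n ξ = ∫ x, (L * L).eval x ∂(gaussianReal 0 1) := by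
    simp only [eval_sub] at hint
    rw [integral_sub (integrable_eval_gaussianReal _) (integrable_eval_gaussianReal _),
      sub_eq_zero] at hint
    exact hint.symm
  have hnn : ∀ x, 0 ≤ (L * L).eval x := fun x => by
    rw [eval_mul]
    exact mul_self_nonneg _
  rw [hsq]
  refine lt_of_le_of_ne (integral_nonneg hnn) fun h => ?_
  have := eq_zero_of_integral_eval_eq_zero hnn h.symm
  have h3 : (L * L).eval ξ = 0 := by rw [this, eval_zero]
  rw [eval_mul, hL1] at h3
  norm_num at h3

/-! ### Spacing of the nodes -/

/-- A nontrivial solution of `u'' = -q u` with `|q| ≤ K` has well separated zeros. -/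
theorem one_le_mul_sq_of_consecutive_zeros {u u' q : ℝ → ℝ} {a b K : ℝ} (hab : a < b)
    (hu : ∀ x, HasDerivAt u (u' x) x) (hu' : ∀ x, HasDerivAt u' (-q x * u x) x)
    (hq : ∀ x ∈ Set.Icc a b, |q x| ≤ K) (ha : u a = 0) (hb : u b = 0)
    (hne : ∃ x ∈ Set.Icc a b, u x ≠ 0) : 1 ≤ K * (b - a) ^ 2 := by
  have hcu : Continuous u := continuous_iff_continuousAt.2 fun x => (hu x).continuousAt
  -- At an interior maximum `c` of `|u|` the derivative vanishes. Two mean value estimates, for `u'`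
  -- from `c` and for `u` from `a`, give `|u c| ≤ K |u c| (b - a)²`.
  obtain ⟨c, hc, hmax⟩ := isCompact_Icc.exists_isMaxOn (Set.nonempty_Icc.2 hab.le)
    (hcu.abs.continuousOn (s := Set.Icc a b))
  obtain ⟨x₀, hx₀, hux₀⟩ := hne
  have hM : 0 < |u c| := (abs_pos.2 hux₀).trans_le (hmax hx₀)
  have hK : 0 ≤ K := (abs_nonneg _).trans (hq c hc)
  have hca : c ≠ a := by rintro rfl; simp [ha] at hM
  have hcb : c ≠ b := by rintro rfl; simp [hb] at hM
  have hco : c ∈ Set.Ioo a b := ⟨lt_of_le_of_ne hc.1 hca.symm, lt_of_le_of_ne hc.2 hcb⟩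
  have hu'c : u' c = 0 := by
    rcases lt_or_gt_of_ne (abs_pos.1 hM) with h | h
    · refine IsLocalMin.hasDerivAt_eq_zero (f := u) ?_ (hu c)
      filter_upwards [Icc_mem_nhds hco.1 hco.2] with x hx
      have := hmax hx
      simp only [Set.mem_ofPred_eq] at this
      rw [abs_of_neg h] at this
      linarith [neg_abs_le (u x)]
    · refine IsLocalMax.hasDerivAt_eq_zero (f := u) ?_ (hu c)
      filter_upwards [Icc_mem_nhds hco.1 hco.2] with x hx
      have := hmax hx
      simp only [Set.mem_ofPred_eq] at this
      rw [abs_of_pos h] at this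
      linarith [le_abs_self (u x)]
  have h1 : ∀ x ∈ Set.Icc a b, |u' x| ≤ K * |u c| * (b - a) := fun x hx => by
    have := (convex_Icc a b).norm_image_sub_le_of_norm_hasDerivWithin_le
      (f := u') (f' := fun x => -q x * u x) (C := K * |u c|)
      (fun y _ => (hu' y).hasDerivWithinAt) (fun y hy => ?_) hc hx
    · rw [hu'c, sub_zero, Real.norm_eq_abs, Real.norm_eq_abs] at this
      refine this.trans (mul_le_mul_of_nonneg_left ?_ (by positivity))
      rw [abs_le]
      constructor <;> linarith [hx.1, hx.2, hc.1, hc.2]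
    · rw [norm_mul, norm_neg]
      exact mul_le_mul (hq y hy) (hmax hy) (abs_nonneg _) hK
  have h2 := (convex_Icc a b).norm_image_sub_le_of_norm_hasDerivWithin_le
      (f := u) (f' := u') (C := K * |u c| * (b - a))
      (fun y _ => (hu y).hasDerivWithinAt) h1 (Set.left_mem_Icc.2 hab.le) hc
  rw [ha, sub_zero, Real.norm_eq_abs, Real.norm_eq_abs] at h2
  have h3 : |c - a| ≤ b - a := by
    rw [abs_le]
    constructor <;> linarith [hc.1, hc.2]
  have hba : 0 ≤ b - a := by linarith
  have h4 : |u c| * 1 ≤ |u c| * (K * (b - a) ^ 2) :=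
    calc |u c| * 1 ≤ K * |u c| * (b - a) * |c - a| := by simpa using h2
      _ ≤ K * |u c| * (b - a) * (b - a) := mul_le_mul_of_nonneg_left h3 (by positivity)
      _ = _ := by ring
  exact le_of_mul_le_mul_left h4 hM

/-- The factor `e^{-x²/4}` removes the first-order term of the Hermite equation; the remaining
coefficient `n + 1/2 - x²/4` lies between `0` and `n + 1/2` on `[0, 1]`. -/
theorem nodes_spacing {n : ℕ} (hn : 1 ≤ n) {x y : ℝ} (hx : x ∈ nodes n) (hy : y ∈ nodes n)
    (h0 : 0 ≤ x) (hxy : x < y) (h1 : y ≤ 1) : 1 ≤ ((n : ℝ) + 1 / 2) * (y - x) ^ 2 := by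
  set H := realHermite n with hH
  set H' := Polynomial.derivative H with hH'
  set e : ℝ → ℝ := fun x => Real.exp (-x ^ 2 / 4) with he
  have hexp : ∀ x, HasDerivAt e (-x / 2 * e x) x := fun x => by
    have : HasDerivAt (fun x : ℝ => -x ^ 2 / 4) (-x / 2) x := by
      convert! ((hasDerivAt_id x).pow 2).neg.div_const 4 using 1
      simp
      ring
    convert! this.exp using 1
    simp only [he]
    ring
  refine one_le_mul_sq_of_consecutive_zeros (u := fun x => H.eval x * e x)
    (u' := fun x => (H'.eval x - x / 2 * H.eval x) * e x)
    (q := fun x => (n : ℝ) + 1 / 2 - x ^ 2 / 4) hxy ?_ ?_ ?_ ?_ ?_ ?_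
  · intro t
    convert! (H.hasDerivAt t).mul (hexp t) using 1
    ring
  · intro t
    convert! ((H'.hasDerivAt t).sub (((hasDerivAt_id t).div_const 2).mul (H.hasDerivAt t))).mul
      (hexp t) using 1
    have := congrArg (Polynomial.eval t) (derivative_derivative_realHermite n)
    simp only [Polynomial.eval_sub, Polynomial.eval_mul, Polynomial.eval_X,
      Polynomial.eval_natCast] at this
    simp only [id, Pi.sub_apply, Pi.mul_apply, hH', hH, this]
    ring
  · intro t ht
    have hn' : (1 : ℝ) ≤ n := by exact_mod_cast hn
    have ht0 : 0 ≤ t := h0.trans ht.1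
    have ht1 : t ≤ 1 := ht.2.trans h1
    rw [abs_le]
    constructor <;> nlinarith
  · simp [mem_nodes.1 hx, hH]
  · simp [mem_nodes.1 hy, hH]
  · by_contra! h
    refine (realHermite_monic n).ne_zero (Polynomial.eq_zero_of_infinite_isRoot _
      ((Set.Icc_infinite hxy).mono fun t ht => ?_))
    have := h t ht
    simpa [he, (Real.exp_pos _).ne'] using this

/-! ### The Gaussian measure on `ℝ^d` and its marginals. -/

instance isProbabilityMeasure_gaussian (d : ℕ) : IsProbabilityMeasure (gaussian d) := by
  unfold gaussian
  infer_instance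

/-- Needed because weak derivatives are unique up to Lebesgue null sets, while the norm integrates
them against the Gaussian. Splitting off one coordinate reduces the claim to a product of two
measures. -/
theorem gaussian_absolutelyContinuous (d : ℕ) : gaussian d ≪ volume := by
  induction d with
  | zero =>
    refine Measure.AbsolutelyContinuous.mk fun s _ hs => ?_
    have : s = ∅ := by
      by_contra h
      obtain ⟨x, hx⟩ := Set.nonempty_iff_ne_empty.2 h
      have hs' : s = Set.univ := Set.eq_univ_of_forall fun y => by
        rwa [Subsingleton.elim y x]
      rw [hs', volume_pi, Measure.pi_univ] at hs
      simp at hs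
    simp [this]
  | succ d ih =>
    have h1 := (measurePreserving_piFinSuccAbove (fun _ : Fin (d + 1) => gaussianReal 0 1) 0).symm
    have h2 := (volume_preserving_piFinSuccAbove (fun _ : Fin (d + 1) => ℝ) 0).symm
    rw [gaussian, ← h1.map_eq, ← h2.map_eq]
    exact ((gaussianReal_absolutelyContinuous 0 one_ne_zero).prod ih).map
      (MeasurableEquiv.measurable _)

theorem measurePreserving_coord {d : ℕ} (j : Fin d) :
    MeasurePreserving (fun x : Fin d → ℝ => x j) (gaussian d) (gaussianReal 0 1) :=
  measurePreserving_eval (fun _ : Fin d => gaussianReal 0 1) j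

theorem integral_coord {d : ℕ} (j : Fin d) {q : ℝ → ℝ} (hq : Continuous q) :
    ∫ x, q (x j) ∂(gaussian d) = ∫ t, q t ∂(gaussianReal 0 1) := by
  rw [← (measurePreserving_coord j).map_eq, integral_map (measurePreserving_coord j).aemeasurable
    hq.aestronglyMeasurable]

/-! ### Weak derivatives -/

theorem IsWeakDeriv.ae_eq {d : ℕ} {r : Fin d → ℕ} {f g g' : (Fin d → ℝ) → ℝ}
    (h : IsWeakDeriv r f g) (h' : IsWeakDeriv r f g') : g =ᵐ[volume] g' := by
  refine ae_eq_of_integral_contDiff_smul_eq h.2.1 h'.2.1 fun φ hφ hc => ?_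
  have h1 := h.2.2 φ hφ hc
  rw [h'.2.2 φ hφ hc] at h1
  have h2 := mul_left_cancel₀ (pow_ne_zero _ (by norm_num)) h1
  simpa [mul_comm] using h2.symm

/-- This lets the arbitrarily chosen `weakDeriv` be replaced by an explicit derivative in the norm.
-/
theorem IsWeakDeriv.weakDeriv_ae_eq {d : ℕ} {r : Fin d → ℕ} {f g : (Fin d → ℝ) → ℝ}
    (h : IsWeakDeriv r f g) : weakDeriv r f =ᵐ[gaussian d] g := by
  have hex : ∃ g, IsWeakDeriv r f g := ⟨g, h⟩
  rw [weakDeriv, dif_pos hex]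
  exact (gaussian_absolutelyContinuous d).ae_eq (hex.choose_spec.ae_eq h)

theorem contDiff_pderiv {d : ℕ} (i : Fin d) {φ : (Fin d → ℝ) → ℝ} (hφ : ContDiff ℝ ∞ φ) :
    ContDiff ℝ ∞ (pderiv i φ) :=
  (hφ.fderiv_right (m := ∞) (by simp)).clm_apply contDiff_const

theorem hasCompactSupport_pderiv {d : ℕ} (i : Fin d) {φ : (Fin d → ℝ) → ℝ}
    (hφ : HasCompactSupport φ) : HasCompactSupport (pderiv i φ) :=
  hφ.fderiv_apply ℝ _

/-- The effect of `∂/∂x_i` on the profile `p` of the function `x ↦ p (x_j)`. -/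
noncomputable def profileDeriv {d : ℕ} (j i : Fin d) (p : ℝ → ℝ) : ℝ → ℝ :=
  if i = j then deriv p else 0

theorem contDiff_deriv {p : ℝ → ℝ} (hp : ContDiff ℝ ∞ p) : ContDiff ℝ ∞ (deriv p) :=
  ((contDiff_succ_iff_deriv (n := ∞)).1 (by simpa using hp)).2.2

theorem contDiff_profileDeriv {d : ℕ} (j i : Fin d) {p : ℝ → ℝ} (hp : ContDiff ℝ ∞ p) :
    ContDiff ℝ ∞ (profileDeriv j i p) := by
  unfold profileDeriv
  split_ifs
  · exact contDiff_deriv hp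
  · exact contDiff_const

theorem contDiff_coord {d : ℕ} (j : Fin d) {p : ℝ → ℝ} (hp : ContDiff ℝ ∞ p) :
    ContDiff ℝ ∞ fun x : Fin d → ℝ => p (x j) :=
  hp.comp (contDiff_apply ℝ ℝ j)

theorem fderiv_coord {d : ℕ} (j i : Fin d) {p : ℝ → ℝ} (hp : ContDiff ℝ ∞ p) (x : Fin d → ℝ) :
    fderiv ℝ (fun x : Fin d → ℝ => p (x j)) x (Pi.single i 1) = profileDeriv j i p (x j) := by
  have h1 : HasFDerivAt (fun x : Fin d → ℝ => x j)
      (ContinuousLinearMap.proj (R := ℝ) (φ := fun _ : Fin d => ℝ) j) x :=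
    (ContinuousLinearMap.proj (R := ℝ) (φ := fun _ : Fin d => ℝ) j).hasFDerivAt
  have h2 : HasDerivAt p (deriv p (x j)) (x j) :=
    ((hp.differentiable (by simp)) (x j)).hasDerivAt
  have h3 : HasFDerivAt (fun x : Fin d → ℝ => p (x j)) _ x := h2.comp_hasFDerivAt x h1
  rw [h3.fderiv]
  unfold profileDeriv
  by_cases h : i = j
  · subst h
    simp
  · simp [h, Ne.symm h]

theorem integral_coord_mul_pderiv {d : ℕ} (j i : Fin d) {p : ℝ → ℝ} (hp : ContDiff ℝ ∞ p)
    {φ : (Fin d → ℝ) → ℝ} (hφ : ContDiff ℝ ∞ φ) (hc : HasCompactSupport φ) :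
    ∫ x, p (x j) * pderiv i φ x = -∫ x, profileDeriv j i p (x j) * φ x := by
  have hpc := (contDiff_coord j hp).continuous
  have hqc := (contDiff_coord j (contDiff_profileDeriv j i hp)).continuous
  have h := integral_mul_fderiv_eq_neg_fderiv_mul_of_integrable (μ := (volume : Measure (Fin d → ℝ)))
    (f := fun x : Fin d → ℝ => p (x j)) (g := φ) (v := Pi.single i 1) ?_ ?_ ?_ ?_ ?_
  · simp only [fderiv_coord j i hp] at h
    exact h
  · simp only [fderiv_coord j i hp]
    exact (hqc.mul hφ.continuous).integrable_of_hasCompactSupport hc.mul_left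
  · exact (hpc.mul (contDiff_pderiv i hφ).continuous).integrable_of_hasCompactSupport
      (hasCompactSupport_pderiv i hc).mul_left
  · exact (hpc.mul hφ.continuous).integrable_of_hasCompactSupport hc.mul_left
  · exact fun x _ => (contDiff_coord j hp).differentiable (by simp) x
  · exact fun x _ => hφ.differentiable (by simp) x

theorem contDiff_iterate_pderiv {d : ℕ} (i : Fin d) (k : ℕ) {φ : (Fin d → ℝ) → ℝ}
    (hφ : ContDiff ℝ ∞ φ) (hc : HasCompactSupport φ) :
    ContDiff ℝ ∞ ((pderiv i)^[k] φ) ∧ HasCompactSupport ((pderiv i)^[k] φ) := by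
  induction k with
  | zero => exact ⟨hφ, hc⟩
  | succ k ih =>
    rw [Function.iterate_succ_apply']
    exact ⟨contDiff_pderiv i ih.1, hasCompactSupport_pderiv i ih.2⟩

theorem contDiff_iterate_profileDeriv {d : ℕ} (j i : Fin d) (k : ℕ) {p : ℝ → ℝ}
    (hp : ContDiff ℝ ∞ p) : ContDiff ℝ ∞ ((profileDeriv j i)^[k] p) := by
  induction k with
  | zero => exact hp
  | succ k ih =>
    rw [Function.iterate_succ_apply']
    exact contDiff_profileDeriv j i ih

theorem integral_coord_mul_iterate_pderiv {d : ℕ} (j i : Fin d) (k : ℕ) {p : ℝ → ℝ}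
    (hp : ContDiff ℝ ∞ p) {φ : (Fin d → ℝ) → ℝ} (hφ : ContDiff ℝ ∞ φ)
    (hc : HasCompactSupport φ) :
    ∫ x, p (x j) * (pderiv i)^[k] φ x =
      (-1 : ℝ) ^ k * ∫ x, (profileDeriv j i)^[k] p (x j) * φ x := by
  induction k generalizing p with
  | zero => simp
  | succ k ih =>
    obtain ⟨h1, h2⟩ := contDiff_iterate_pderiv i k hφ hc
    rw [Function.iterate_succ_apply', integral_coord_mul_pderiv j i hp h1 h2,
      ih (contDiff_profileDeriv j i hp), Function.iterate_succ_apply]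
    ring

/-- The profile of the mixed derivative of `x ↦ p (x_j)` in the directions of the list `l`. -/
noncomputable def profileMderiv {d : ℕ} (j : Fin d) (r : Fin d → ℕ) (l : List (Fin d))
    (p : ℝ → ℝ) : ℝ → ℝ :=
  l.foldl (fun q i => (profileDeriv j i)^[r i] q) p

theorem contDiff_profileMderiv {d : ℕ} (j : Fin d) (r : Fin d → ℕ) (l : List (Fin d))
    {p : ℝ → ℝ} (hp : ContDiff ℝ ∞ p) : ContDiff ℝ ∞ (profileMderiv j r l p) := by
  induction l generalizing p with
  | nil => exact hp
  | cons i l ih => exact ih (contDiff_iterate_profileDeriv j i (r i) hp)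

/-- The head of the list is the outermost derivative of `φ`, hence the first one moved onto `p`: a
`foldr` on `φ` becomes a `foldl` on the profile. -/
theorem integral_coord_mul_foldr_pderiv {d : ℕ} (j : Fin d) (r : Fin d → ℕ) (l : List (Fin d))
    {p : ℝ → ℝ} (hp : ContDiff ℝ ∞ p) {φ : (Fin d → ℝ) → ℝ} (hφ : ContDiff ℝ ∞ φ)
    (hc : HasCompactSupport φ) :
    ∫ x, p (x j) * l.foldr (fun i ψ => (pderiv i)^[r i] ψ) φ x =
      (-1 : ℝ) ^ (l.map r).sum * ∫ x, profileMderiv j r l p (x j) * φ x := by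
  have hs : ∀ l : List (Fin d), ContDiff ℝ ∞ (l.foldr (fun i ψ => (pderiv i)^[r i] ψ) φ) ∧
      HasCompactSupport (l.foldr (fun i ψ => (pderiv i)^[r i] ψ) φ) := fun l => by
    induction l with
    | nil => exact ⟨hφ, hc⟩
    | cons i l ih => exact contDiff_iterate_pderiv i (r i) ih.1 ih.2
  induction l generalizing p with
  | nil => simp [profileMderiv]
  | cons i l ih =>
    rw [List.foldr_cons, integral_coord_mul_iterate_pderiv j i (r i) hp (hs l).1 (hs l).2,
      ih (contDiff_iterate_profileDeriv j i (r i) hp), List.map_cons, List.sum_cons, pow_add,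
      mul_assoc]
    rfl

theorem isWeakDeriv_coord_profileMderiv {d : ℕ} (j : Fin d) (r : Fin d → ℕ) {p : ℝ → ℝ}
    (hp : ContDiff ℝ ∞ p) : IsWeakDeriv r (fun x : Fin d → ℝ => p (x j))
      fun x => profileMderiv j r (List.finRange d) p (x j) := by
  refine ⟨(contDiff_coord j hp).continuous.locallyIntegrable,
    (contDiff_coord j (contDiff_profileMderiv j r _ hp)).continuous.locallyIntegrable,
    fun φ hφ hc => ?_⟩
  have := integral_coord_mul_foldr_pderiv j r (List.finRange d) hp hφ hc
  rwa [← List.ofFn_eq_map, List.sum_ofFn] at this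

theorem profileMderiv_zero {d : ℕ} (j : Fin d) (r : Fin d → ℕ) (l : List (Fin d)) :
    profileMderiv j r l 0 = 0 := by
  have h0 : ∀ i, profileDeriv j i 0 = 0 := fun i => by
    unfold profileDeriv
    split_ifs
    · ext x
      exact deriv_const x (0 : ℝ)
    · rfl
  induction l with
  | nil => rfl
  | cons i l ih =>
    change profileMderiv j r l ((profileDeriv j i)^[r i] 0) = 0
    rwa [Function.iterate_fixed (h0 i)]

theorem profileMderiv_of_exists {d : ℕ} {j : Fin d} {r : Fin d → ℕ} {l : List (Fin d)}
    (h : ∃ i ∈ l, i ≠ j ∧ r i ≠ 0) (p : ℝ → ℝ) : profileMderiv j r l p = 0 := by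
  induction l generalizing p with
  | nil => simp at h
  | cons i l ih =>
    change profileMderiv j r l ((profileDeriv j i)^[r i] p) = 0
    by_cases hi : i ≠ j ∧ r i ≠ 0
    · obtain ⟨s, hs⟩ := Nat.exists_eq_succ_of_ne_zero hi.2
      have : (profileDeriv j i)^[r i] p = 0 := by
        rw [hs, Function.iterate_succ_apply', profileDeriv, if_neg hi.1]
      rw [this, profileMderiv_zero]
    · refine ih ?_ _
      obtain ⟨i', hi', h'⟩ := h
      rcases List.mem_cons.1 hi' with rfl | hm
      · exact absurd h' hi
      · exact ⟨i', hm, h'⟩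

/-- Each occurrence of `j` in the list contributes `r j` derivatives; the count makes the induction
work, and it is `1` for `List.finRange d`. -/
theorem profileMderiv_of_forall {d : ℕ} {j : Fin d} {r : Fin d → ℕ} {l : List (Fin d)}
    (h : ∀ i ∈ l, i ≠ j → r i = 0) (p : ℝ → ℝ) :
    profileMderiv j r l p = deriv^[l.count j * r j] p := by
  induction l generalizing p with
  | nil => simp [profileMderiv]
  | cons i l ih =>
    change profileMderiv j r l ((profileDeriv j i)^[r i] p) = _
    rw [ih fun i' hi' => h i' (List.mem_cons_of_mem _ hi')]
    by_cases hij : i = j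
    · subst hij
      have : profileDeriv (d := d) i i = deriv := by
        ext1 q
        simp [profileDeriv]
      rw [this, ← Function.iterate_add_apply, List.count_cons_self, Nat.succ_mul]
    · rw [h i List.mem_cons_self hij, List.count_cons_of_ne hij]
      rfl

theorem isWeakDeriv_coord {d : ℕ} (j : Fin d) {r : Fin d → ℕ} (hr : ∀ i, i ≠ j → r i = 0)
    {p : ℝ → ℝ} (hp : ContDiff ℝ ∞ p) :
    IsWeakDeriv r (fun x : Fin d → ℝ => p (x j)) fun x => iteratedDeriv (r j) p (x j) := by
  have := isWeakDeriv_coord_profileMderiv j r hp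
  rwa [profileMderiv_of_forall (fun i _ => hr i), List.count_eq_one_of_mem (List.nodup_finRange d)
    (List.mem_finRange j), one_mul, ← iteratedDeriv_eq_iterate] at this

theorem isWeakDeriv_coord_zero {d : ℕ} (j : Fin d) {r : Fin d → ℕ} (hr : ∃ i, i ≠ j ∧ r i ≠ 0)
    {p : ℝ → ℝ} (hp : ContDiff ℝ ∞ p) :
    IsWeakDeriv r (fun x : Fin d → ℝ => p (x j)) 0 := by
  have := isWeakDeriv_coord_profileMderiv j r hp
  obtain ⟨i, hi⟩ := hr
  rwa [profileMderiv_of_exists ⟨i, List.mem_finRange i, hi⟩] at this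

theorem memSobolev_coord {d : ℕ} (α : ℕ) (j : Fin d) {p : ℝ → ℝ} (hp : ContDiff ℝ ∞ p)
    (hL : ∀ k ≤ α, MemLp (iteratedDeriv k p) 2 (gaussianReal 0 1)) :
    MemSobolev α fun x : Fin d → ℝ => p (x j) := by
  refine ⟨(contDiff_coord j hp).continuous, fun r hr => ?_⟩
  by_cases h : ∀ i, i ≠ j → r i = 0
  · exact ⟨_, isWeakDeriv_coord j h hp,
      (hL (r j) (hr j)).comp_measurePreserving (measurePreserving_coord j)⟩
  · push Not at h
    exact ⟨_, isWeakDeriv_coord_zero j h hp, MemLp.zero⟩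

/-- Derivatives in any direction other than `j` vanish, so only multi-indices supported at `j`
survive. The norm does not depend on `d`, and therefore neither does the final constant. -/
theorem sobolevNorm_coord {d : ℕ} (α : ℕ) (j : Fin d) {p : ℝ → ℝ} (hp : ContDiff ℝ ∞ p) :
    sobolevNorm α (fun x : Fin d → ℝ => p (x j)) =
      √(∑ k : Fin (α + 1), ∫ t, iteratedDeriv k p t ^ 2 ∂(gaussianReal 0 1)) := by
  rw [sobolevNorm]
  congr 1
  symm
  refine Finset.sum_of_injOn (fun k => Pi.single j k) (fun _ _ _ _ h => Pi.single_injective (M := fun _ : Fin d => Fin (α + 1)) j h)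
    (fun _ _ => by simp) (fun r _ hr => ?_) fun k _ => ?_
  · have h : ∃ i, i ≠ j ∧ (r i : ℕ) ≠ 0 := by
      by_contra! h
      refine hr ⟨r j, by simp, ?_⟩
      ext i
      by_cases hi : i = j
      · subst hi
        simp
      · simp [hi, h i hi]
    have h1 := (isWeakDeriv_coord_zero j (r := fun i => (r i : ℕ)) h hp).weakDeriv_ae_eq
    refine integral_eq_zero_of_ae ?_
    filter_upwards [h1] with x hx
    simp [hx]
  · have h1 := (isWeakDeriv_coord j (r := fun i => ((Pi.single j k : Fin d → Fin (α + 1)) i : ℕ))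
      (fun i hi => by simp [hi]) hp).weakDeriv_ae_eq
    rw [← integral_coord j (q := fun t => iteratedDeriv k p t ^ 2)
      ((hp.continuous_iteratedDeriv k (by exact_mod_cast le_top)).pow 2)]
    refine integral_congr_ae ?_
    filter_upwards [h1] with x hx
    simp [hx]

/-! ### Fooling profiles -/

theorem exists_unit_bump : ∃ φ : ℝ → ℝ, ContDiff ℝ ∞ φ ∧ (∀ x, 0 ≤ φ x) ∧ Integrable φ ∧
    0 < ∫ x, φ x ∧ (∀ k x, x ∉ Set.Ioo (0 : ℝ) 1 → iteratedDeriv k φ x = 0) ∧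
    ∀ k, ∃ B, ∀ x, |iteratedDeriv k φ x| ≤ B := by
  -- The closed support `[1/4, 3/4]` lies inside `(0, 1)`, so integer translates are disjointly
  -- supported, with all their derivatives.
  let φ : ContDiffBump (1 / 2 : ℝ) := ⟨1 / 8, 1 / 4, by norm_num, by norm_num⟩
  have hφ : ContDiff ℝ ∞ φ := φ.contDiff
  have hs : ∀ k, tsupport (iteratedDeriv k φ) ⊆ tsupport φ := fun k => by
    induction k with
    | zero => rw [iteratedDeriv_zero]
    | succ k ih =>
      rw [iteratedDeriv_succ]
      exact tsupport_deriv_subset.trans ih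
  refine ⟨φ, hφ, fun x => φ.nonneg, φ.continuous.integrable_of_hasCompactSupport
    φ.hasCompactSupport, φ.integral_pos, fun k x hx => ?_, fun k => ?_⟩
  · by_contra h
    have h1 : x ∈ tsupport φ := hs k (subset_tsupport _ h)
    rw [φ.tsupport_eq, Real.closedBall_eq_Icc] at h1
    have h2 : φ.rOut = 1 / 4 := rfl
    rw [h2] at h1
    exact hx ⟨by linarith [h1.1], by linarith [h1.2]⟩
  · have hc : HasCompactSupport (iteratedDeriv k φ) :=
      φ.hasCompactSupport.of_isClosed_subset (isClosed_tsupport _) (hs k)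
    exact hc.exists_bound_of_continuous
      (hφ.continuous_iteratedDeriv k (by exact_mod_cast le_top))

/-- A sum of bumps, each living on a cell of the grid of mesh `1 / M`. -/
def bumpSum (φ : ℝ → ℝ) (M : ℝ) (e : ℕ → ℕ) (m : ℕ) (x : ℝ) : ℝ :=
  ∑ i ∈ Finset.range m, φ (M * x - e i)

theorem contDiff_bump_comp {φ : ℝ → ℝ} (hφ : ContDiff ℝ ∞ φ) (M s : ℝ) :
    ContDiff ℝ ∞ fun x => φ (M * x - s) :=
  hφ.comp ((contDiff_const.mul contDiff_id).sub contDiff_const)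

theorem contDiff_bumpSum {φ : ℝ → ℝ} (hφ : ContDiff ℝ ∞ φ) (M : ℝ) (e : ℕ → ℕ) (m : ℕ) :
    ContDiff ℝ ∞ (bumpSum φ M e m) :=
  ContDiff.sum fun i _ => contDiff_bump_comp hφ M (e i)

theorem iteratedDeriv_bumpSum {φ : ℝ → ℝ} (hφ : ContDiff ℝ ∞ φ) (M : ℝ) (e : ℕ → ℕ) (m k : ℕ)
    (x : ℝ) : iteratedDeriv k (bumpSum φ M e m) x =
      M ^ k * ∑ i ∈ Finset.range m, iteratedDeriv k φ (M * x - e i) := by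
  have hk : (k : WithTop ℕ∞) ≤ ∞ := by exact_mod_cast le_top
  unfold bumpSum
  rw [iteratedDeriv_fun_sum fun i _ => ((contDiff_bump_comp hφ M (e i)).of_le hk).contDiffAt,
    Finset.mul_sum]
  refine Finset.sum_congr rfl fun i _ => ?_
  have h := iteratedDeriv_comp_const_mul (n := k) (f := fun y => φ (y - e i))
    ((hφ.comp (contDiff_id.sub contDiff_const)).of_le hk) M
  rw [h, iteratedDeriv_comp_sub_const]

/-- Distinct cells are disjoint, so at most one summand is nonzero at `x`, and the bound does not
grow with the number of bumps. -/
theorem abs_iteratedDeriv_bumpSum_le {φ : ℝ → ℝ} (hφ : ContDiff ℝ ∞ φ)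
    (h0 : ∀ k x, x ∉ Set.Ioo (0 : ℝ) 1 → iteratedDeriv k φ x = 0) {M : ℝ} (hM : 0 ≤ M)
    {e : ℕ → ℕ} (he : Function.Injective e) (m k : ℕ) {B : ℝ}
    (hB : ∀ x, |iteratedDeriv k φ x| ≤ B) (x : ℝ) :
    |iteratedDeriv k (bumpSum φ M e m) x| ≤ M ^ k * B := by
  have hB0 : 0 ≤ B := (abs_nonneg _).trans (hB 0)
  rw [iteratedDeriv_bumpSum hφ, abs_mul, abs_of_nonneg (pow_nonneg hM k)]
  refine mul_le_mul_of_nonneg_left ?_ (pow_nonneg hM k)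
  by_cases h : ∃ i ∈ Finset.range m, M * x - e i ∈ Set.Ioo (0 : ℝ) 1
  · obtain ⟨i, hi, hx⟩ := h
    rw [Finset.sum_eq_single_of_mem i hi]
    · exact hB _
    · intro i' _ hne
      refine h0 k _ fun hx' => hne (he ?_)
      have h1 : (e i' : ℝ) < e i + 1 := by linarith [hx.2, hx'.1]
      have h2 : (e i : ℝ) < e i' + 1 := by linarith [hx'.2, hx.1]
      have h3 : e i' < e i + 1 := by exact_mod_cast h1
      have h4 : e i < e i' + 1 := by exact_mod_cast h2
      omega
  · push Not at h
    rw [Finset.sum_eq_zero fun i hi => h0 k _ (h i hi), abs_zero]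
    exact hB0

theorem gaussianPDFReal_one_le {x : ℝ} (hx : x ∈ Set.Icc (0 : ℝ) 1) :
    gaussianPDFReal 0 1 1 ≤ gaussianPDFReal 0 1 x := by
  simp only [gaussianPDFReal]
  refine mul_le_mul_of_nonneg_left (Real.exp_le_exp.2 ?_) (by positivity)
  have : x ^ 2 ≤ 1 := by nlinarith [hx.1, hx.2]
  simp only [sub_zero, NNReal.coe_one]
  linarith

/-- All cells lie in `[0, 1]`, where the Gaussian density is at least its value at `1`; each bump
has Lebesgue mass `M⁻¹ ∫ φ`. -/
theorem integral_gaussian_bumpSum_ge {φ : ℝ → ℝ} (hnn : ∀ x, 0 ≤ φ x)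
    (hi : Integrable φ) (h0 : ∀ x, x ∉ Set.Ioo (0 : ℝ) 1 → φ x = 0) {M : ℝ} (hM : 0 < M)
    {e : ℕ → ℕ} {m : ℕ} (hm : ∀ i < m, (e i : ℝ) + 1 ≤ M) :
    gaussianPDFReal 0 1 1 * (m * (M⁻¹ * ∫ x, φ x)) ≤
      ∫ x, bumpSum φ M e m x ∂(gaussianReal 0 1) := by
  have hint : ∀ s : ℝ, Integrable (fun x => φ (M * x - s)) ∧
      ∫ x, φ (M * x - s) = M⁻¹ * ∫ x, φ x := fun s => by
    refine ⟨(hi.comp_sub_right s).comp_mul_left' hM.ne', ?_⟩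
    rw [Measure.integral_comp_mul_left (fun y => φ (y - s)) M, integral_sub_right_eq_self φ s,
      abs_of_pos (inv_pos.2 hM), smul_eq_mul]
  have hIs : Integrable (bumpSum φ M e m) := integrable_finsetSum _ fun i _ => (hint (e i)).1
  have h1 : ∫ x, bumpSum φ M e m x = m * (M⁻¹ * ∫ x, φ x) := by
    unfold bumpSum
    rw [integral_finsetSum _ fun i _ => (hint (e i)).1]
    simp [(hint _).2]
  have hnn' : ∀ x, 0 ≤ bumpSum φ M e m x := fun x => Finset.sum_nonneg fun i _ => hnn _
  rw [← h1, ← integral_const_mul, integral_gaussianReal_eq_integral_smul one_ne_zero]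
  refine integral_mono (hIs.const_mul _) ?_ fun x => ?_
  · simp only [smul_eq_mul]
    refine hIs.bdd_mul (c := gaussianPDFReal 0 1 0)
      (measurable_gaussianPDFReal _ _).aestronglyMeasurable (ae_of_all _ fun x => ?_)
    rw [Real.norm_eq_abs, abs_of_nonneg (gaussianPDFReal_nonneg _ _ _)]
    simp only [gaussianPDFReal]
    refine mul_le_mul_of_nonneg_left (Real.exp_le_exp.2 ?_) (by positivity)
    simp only [sub_zero, NNReal.coe_one]
    nlinarith [sq_nonneg x]
  · simp only [smul_eq_mul]
    by_cases hx : x ∈ Set.Icc (0 : ℝ) 1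
    · exact mul_le_mul_of_nonneg_right (gaussianPDFReal_one_le hx) (hnn' x)
    · have : bumpSum φ M e m x = 0 := by
        refine Finset.sum_eq_zero fun i hi => h0 _ fun h => hx ?_
        have h2 := hm i (Finset.mem_range.1 hi)
        have h3 : (0 : ℝ) ≤ e i := Nat.cast_nonneg _
        have h4 := h.1
        have h5 := h.2
        constructor <;> by_contra! h6 <;> nlinarith
      simp [this]

/-- Cut `[0, 1]` into `2m` cells and pair the cells `2i` and `2i + 1`. Points of `X` inside both
cells of a pair would be less than `1 / m` apart, so each pair has a free cell. -/
theorem exists_cells {X : Finset ℝ} {m : ℕ} (hm : 1 ≤ m)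
    (hX : ∀ x ∈ X, ∀ y ∈ X, 0 ≤ x → x < y → y ≤ 1 → 1 ≤ m * (y - x)) :
    ∃ e : ℕ → ℕ, Function.Injective e ∧ (∀ i < m, e i + 1 ≤ 2 * m) ∧
      ∀ i < m, ∀ x ∈ X, 2 * m * x - e i ∉ Set.Ioo (0 : ℝ) 1 := by
  have hm0 : (0 : ℝ) < m := by exact_mod_cast hm
  have h : ∀ i, ∃ k, (k = 2 * i ∨ k = 2 * i + 1) ∧
      (i < m → ∀ x ∈ X, 2 * m * x - (k : ℕ) ∉ Set.Ioo (0 : ℝ) 1) := fun i => by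
    by_contra! hcon
    obtain ⟨hi, x, hx, hx'⟩ := hcon (2 * i) (Or.inl rfl)
    obtain ⟨-, y, hy, hy'⟩ := hcon (2 * i + 1) (Or.inr rfl)
    have hi' : (i : ℝ) + 1 ≤ m := by exact_mod_cast hi
    have hi0 : (0 : ℝ) ≤ i := Nat.cast_nonneg i
    push_cast at hx' hy'
    obtain ⟨h1, h2⟩ := hx'
    obtain ⟨h3, h4⟩ := hy'
    have h0 : 0 ≤ x := by by_contra!; nlinarith
    have hxy : x < y := by by_contra!; nlinarith
    have hy1 : y ≤ 1 := by by_contra!; nlinarith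
    have := hX x hx y hy h0 hxy hy1
    nlinarith
  choose e he hfree using h
  refine ⟨e, fun i i' hii => ?_, fun i hi => ?_, hfree⟩
  · have := he i
    have := he i'
    omega
  · have := he i
    omega

/-- If the points of `X` in `[0, 1]` are `1 / m`-separated, some smooth function vanishing on `X`
has a mean bounded below and derivatives of order `k` bounded by a multiple of `m ^ k`. -/
theorem exists_profile_vanishing_on (α : ℕ) : ∃ a C : ℝ, 0 < a ∧ 0 < C ∧
    ∀ (X : Finset ℝ) (m : ℕ), 1 ≤ m →
      (∀ x ∈ X, ∀ y ∈ X, 0 ≤ x → x < y → y ≤ 1 → 1 ≤ m * (y - x)) →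
      ∃ p : ℝ → ℝ, ContDiff ℝ ∞ p ∧ (∀ x ∈ X, p x = 0) ∧
        (∀ k, MemLp (iteratedDeriv k p) 2 (gaussianReal 0 1)) ∧
        a ≤ ∫ x, p x ∂(gaussianReal 0 1) ∧
        √(∑ k : Fin (α + 1), ∫ t, iteratedDeriv k p t ^ 2 ∂(gaussianReal 0 1)) ≤
          C * (2 * m) ^ α := by
  obtain ⟨φ, hφ, hnn, hi, hpos, h0, hB⟩ := exists_unit_bump
  choose B hB using hB
  have hB0 : ∀ k, 0 ≤ B k := fun k => (abs_nonneg _).trans (hB k 0)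
  have hφ0 : ∀ x, x ∉ Set.Ioo (0 : ℝ) 1 → φ x = 0 := fun x hx => by simpa using h0 0 x hx
  -- With mesh `1 / (2m)`, the `m` bumps have total Lebesgue mass `(∫ φ) / 2`. The `+ 1` only keeps
  -- `C` positive.
  refine ⟨gaussianPDFReal 0 1 1 * ((∫ x, φ x) / 2), √(∑ k : Fin (α + 1), B k ^ 2) + 1,
    mul_pos (gaussianPDFReal_pos _ _ _ one_ne_zero) (half_pos hpos), by positivity,
    fun X m hm hX => ?_⟩
  obtain ⟨e, he, hle, hfree⟩ := exists_cells hm hX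
  have hm1 : (1 : ℝ) ≤ m := by exact_mod_cast hm
  have hM : (0 : ℝ) < 2 * m := by linarith
  have hM1 : (1 : ℝ) ≤ 2 * m := by linarith
  have hcd := contDiff_bumpSum hφ (2 * m) e m
  have hbd := fun k x => abs_iteratedDeriv_bumpSum_le hφ h0 hM.le he m k (hB k) x
  have hcont : ∀ k, Continuous (iteratedDeriv k (bumpSum φ (2 * m) e m)) := fun k =>
    hcd.continuous_iteratedDeriv k (by exact_mod_cast le_top)
  refine ⟨bumpSum φ (2 * m) e m, hcd, fun x hx => Finset.sum_eq_zero fun i hi' =>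
    hφ0 _ (hfree i (Finset.mem_range.1 hi') x hx), fun k =>
    MemLp.of_bound (hcont k).aestronglyMeasurable _ (ae_of_all _ (hbd k)), ?_, ?_⟩
  · refine le_trans (le_of_eq ?_) (integral_gaussian_bumpSum_ge hnn hi hφ0 hM fun i hi' => ?_)
    · field_simp
    · exact_mod_cast hle i hi'
  -- Since `2m ≥ 1`, the factor `(2m)^k` is at most `(2m)^α` for every order `k ≤ α`.
  · have hk : ∀ k : Fin (α + 1),
        ∫ t, iteratedDeriv k (bumpSum φ (2 * m) e m) t ^ 2 ∂(gaussianReal 0 1) ≤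
          B k ^ 2 * ((2 * m : ℝ) ^ α) ^ 2 := fun k => by
      have h1 : ∀ t, iteratedDeriv k (bumpSum φ (2 * m) e m) t ^ 2 ≤
          B k ^ 2 * ((2 * m : ℝ) ^ α) ^ 2 := fun t => by
        rw [← sq_abs, ← mul_pow]
        refine pow_le_pow_left₀ (abs_nonneg _) ((hbd k t).trans ?_) 2
        rw [mul_comm]
        exact mul_le_mul_of_nonneg_left (pow_le_pow_right₀ hM1 (by omega)) (hB0 k)
      refine (integral_mono_of_nonneg (ae_of_all _ fun t => sq_nonneg _) (integrable_const _)
        (ae_of_all _ h1)).trans ?_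
      simp
    calc √(∑ k : Fin (α + 1), ∫ t, iteratedDeriv k (bumpSum φ (2 * m) e m) t ^ 2
          ∂(gaussianReal 0 1)) ≤ √((∑ k : Fin (α + 1), B k ^ 2) * ((2 * m : ℝ) ^ α) ^ 2) := by
            refine Real.sqrt_le_sqrt ?_
            rw [Finset.sum_mul]
            exact Finset.sum_le_sum fun k _ => hk k
      _ = √(∑ k : Fin (α + 1), B k ^ 2) * (2 * m) ^ α := by
        rw [Real.sqrt_mul (Finset.sum_nonneg fun k _ => sq_nonneg _), Real.sqrt_sq (by positivity)]
      _ ≤ _ := mul_le_mul_of_nonneg_right (by linarith) (by positivity)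

theorem sobolev_profile_pos {α : ℕ} {p : ℝ → ℝ}
    (hL : MemLp p 2 (gaussianReal 0 1)) (hp : ∫ x, p x ∂(gaussianReal 0 1) ≠ 0) :
    0 < √(∑ k : Fin (α + 1), ∫ t, iteratedDeriv k p t ^ 2 ∂(gaussianReal 0 1)) := by
  refine Real.sqrt_pos.2 (Finset.sum_pos' (fun k _ => integral_nonneg fun t => sq_nonneg _)
    ⟨0, Finset.mem_univ _, ?_⟩)
  simp only [Fin.val_zero, iteratedDeriv_zero]
  refine lt_of_le_of_ne (integral_nonneg fun t => sq_nonneg _) fun h => hp ?_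
  have h1 := (integral_eq_zero_iff_of_nonneg (fun t => sq_nonneg _) hL.integrable_sq).1 h.symm
  refine integral_eq_zero_of_ae ?_
  filter_upwards [h1] with t ht
  simpa using ht

/-- The fooling profile for the Gauss–Hermite nodes. -/
theorem exists_fooling_profile (α : ℕ) : ∃ c : ℝ, 0 < c ∧ ∀ n : ℕ, 1 ≤ n →
    ∃ p : ℝ → ℝ, ContDiff ℝ ∞ p ∧ (∀ x ∈ nodes n, p x = 0) ∧ p ≠ 0 ∧
      (∀ k, MemLp (iteratedDeriv k p) 2 (gaussianReal 0 1)) ∧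
      c * (n : ℝ) ^ (-(α : ℝ) / 2) ≤ |∫ x, p x ∂(gaussianReal 0 1)| /
        √(∑ k : Fin (α + 1), ∫ t, iteratedDeriv k p t ^ 2 ∂(gaussianReal 0 1)) := by
  obtain ⟨a, C, ha, hC, H⟩ := exists_profile_vanishing_on α
  refine ⟨a / (C * 4 ^ α), by positivity, fun n hn => ?_⟩
  -- This choice gives `m² ≥ n + 1/2`, so the spacing of the nodes is at least `1 / m`, and `2m ≤
  -- 4√n`, whence the factor `4 ^ α` in the constant.
  set m := Nat.sqrt n + 1 with hm
  have hn0 : (0 : ℝ) < n := by exact_mod_cast hn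
  have hmn : (n : ℝ) + 1 ≤ (m : ℝ) ^ 2 := by
    have := Nat.lt_succ_sqrt' n
    exact_mod_cast this
  have hm2 : (2 * m : ℝ) ≤ 4 * √n := by
    have h1 : (Nat.sqrt n : ℝ) ≤ √n := Real.nat_sqrt_le_real_sqrt
    have h2 : (1 : ℝ) ≤ √n := Real.one_le_sqrt.2 (by exact_mod_cast hn)
    rw [hm]
    push_cast
    linarith
  obtain ⟨p, hp, hv, hL, hI, hN⟩ := H (nodes n) m (by omega) fun x hx y hy h0 hxy h1 => by
    have h2 := nodes_spacing hn hx hy h0 hxy h1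
    have h3 : (1 : ℝ) ^ 2 ≤ (m * (y - x)) ^ 2 := by
      rw [mul_pow]
      nlinarith [sq_nonneg (y - x)]
    exact le_of_sq_le_sq h3 (mul_nonneg (Nat.cast_nonneg _) (by linarith))
  have hI0 : ∫ x, p x ∂(gaussianReal 0 1) ≠ 0 := (ha.trans_le hI).ne'
  refine ⟨p, hp, hv, ?_, hL, ?_⟩
  · rintro rfl
    simp at hI0
  -- The upper bound on the norm can be inverted only if the norm is nonzero, as division by zero
  -- yields `0`.
  have hpos : 0 < √(∑ k : Fin (α + 1), ∫ t, iteratedDeriv k p t ^ 2 ∂(gaussianReal 0 1)) :=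
    sobolev_profile_pos (by simpa using hL 0) hI0
  have hpow : (n : ℝ) ^ (-(α : ℝ) / 2) = (√n ^ α)⁻¹ := by
    rw [neg_div, Real.rpow_neg hn0.le, Real.sqrt_eq_rpow, ← Real.rpow_mul_natCast hn0.le]
    congr 2
    ring
  calc a / (C * 4 ^ α) * (n : ℝ) ^ (-(α : ℝ) / 2) = a / (C * (4 * √n) ^ α) := by
        rw [hpow, mul_pow, ← mul_assoc, ← div_eq_mul_inv, div_div]
    _ ≤ a / √(∑ k : Fin (α + 1), ∫ t, iteratedDeriv k p t ^ 2 ∂(gaussianReal 0 1)) := by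
        refine div_le_div_of_nonneg_left ha.le hpos (hN.trans ?_)
        exact mul_le_mul_of_nonneg_left (pow_le_pow_left₀ (by positivity) hm2 α) hC.le
    _ ≤ _ := div_le_div_of_nonneg_right (hI.trans (le_abs_self _)) hpos.le

/-! ### Sparse grids on functions of one coordinate -/

theorem linearCombination_uniRule (n : ℕ → ℕ) (W : ℕ → ℝ → ℝ) (g : ℝ → ℝ) {ℓ : ℕ} (hℓ : 1 ≤ ℓ) :
    Finsupp.linearCombination ℝ g (uniRule n W ℓ) = ∑ ξ ∈ nodes (n ℓ), W ℓ ξ * g ξ := by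
  rw [uniRule, if_neg (by omega), map_sum]
  simp

theorem linearCombination_uniRule_zero (n : ℕ → ℕ) (W : ℕ → ℝ → ℝ) (g : ℝ → ℝ) :
    Finsupp.linearCombination ℝ g (uniRule n W 0) = 0 := by
  simp [uniRule]

theorem linearCombination_diffRule (n : ℕ → ℕ) (W : ℕ → ℝ → ℝ) (g : ℝ → ℝ) {ℓ : ℕ}
    (hℓ : 1 ≤ ℓ) : Finsupp.linearCombination ℝ g (diffRule n W ℓ) =
      Finsupp.linearCombination ℝ g (uniRule n W ℓ) -
        Finsupp.linearCombination ℝ g (uniRule n W (ℓ - 1)) := by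
  rw [diffRule, if_neg (by omega), map_sub]

/-- Exactness for constants makes consecutive rules cancel on `1`, except at level `1`, where the
rule below is zero. -/
theorem linearCombination_diffRule_one {n : ℕ → ℕ} {W : ℕ → ℝ → ℝ}
    (hW : ∀ ℓ, 1 ≤ ℓ → ∑ ξ ∈ nodes (n ℓ), W ℓ ξ = 1) {ℓ : ℕ} (hℓ : 1 ≤ ℓ) :
    Finsupp.linearCombination ℝ (fun _ : ℝ => (1 : ℝ)) (diffRule n W ℓ) =
      if ℓ = 1 then 1 else 0 := by
  have h1 : ∀ ℓ, 1 ≤ ℓ →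
      Finsupp.linearCombination ℝ (fun _ : ℝ => (1 : ℝ)) (uniRule n W ℓ) = 1 := fun ℓ hℓ => by
    simp [linearCombination_uniRule n W _ hℓ, hW ℓ hℓ]
  rw [linearCombination_diffRule n W _ hℓ, h1 ℓ hℓ]
  split_ifs with h
  · subst h
    simp [linearCombination_uniRule_zero]
  · rw [h1 (ℓ - 1) (by omega), sub_self]

theorem sum_linearCombination_diffRule (n : ℕ → ℕ) (W : ℕ → ℝ → ℝ) (g : ℝ → ℝ) (L : ℕ) :
    ∑ k ∈ Finset.Icc 1 L, Finsupp.linearCombination ℝ g (diffRule n W k) =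
      Finsupp.linearCombination ℝ g (uniRule n W L) := by
  induction L with
  | zero => simp [linearCombination_uniRule_zero]
  | succ L ih =>
    rw [Finset.sum_Icc_succ_top (by omega), ih, linearCombination_diffRule n W g (by omega)]
    simp

/-- The integrand is a product of univariate functions, with factor `1` off `j`, so the sum over the
product grid factorizes. -/
theorem tensorRule_coord {d : ℕ} (R : Fin d → (ℝ →₀ ℝ)) (j : Fin d) (p : ℝ → ℝ) :
    tensorRule R (fun x => p (x j)) =
      ∏ i, Finsupp.linearCombination ℝ (if i = j then p else fun _ => 1) (R i) := by
  simp only [Finsupp.linearCombination_apply, Finsupp.sum, smul_eq_mul]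
  rw [Finset.prod_univ_sum, tensorRule]
  refine Finset.sum_congr rfl fun x _ => ?_
  rw [Finset.prod_mul_distrib]
  congr 1
  rw [Finset.prod_eq_single j]
  · simp
  · intro i _ hi
    simp [hi]
  · simp

/-- An index with some entry other than `1` off `j` contributes a factor `Δ_ℓ(1) = 0`; the remaining
ones telescope. Exactness is used only in coordinates other than `j`, so `hW` is vacuous for `d =
1`. -/
theorem sparseQuad_coord {d : ℕ} {n : ℕ → ℕ} {W : ℕ → ℝ → ℝ} {Λ : Finset (Fin d → ℕ)}
    (hΛ : ∀ ℓ ∈ Λ, ∀ i, 1 ≤ ℓ i) {j : Fin d} {L : ℕ}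
    (hL : ∀ k, Function.update (1 : Fin d → ℕ) j k ∈ Λ ↔ 1 ≤ k ∧ k ≤ L)
    (hW : ∀ i : Fin d, i ≠ j → ∀ ℓ, 1 ≤ ℓ → ∑ ξ ∈ nodes (n ℓ), W ℓ ξ = 1) (p : ℝ → ℝ) :
    sparseQuad n W Λ (fun x => p (x j)) = Finsupp.linearCombination ℝ p (uniRule n W L) := by
  rw [sparseQuad, ← sum_linearCombination_diffRule]
  symm
  refine Finset.sum_of_injOn (Function.update (1 : Fin d → ℕ) j)
    (Function.update_injective _ j).injOn (fun k hk => ?_) (fun ℓ hℓ hnot => ?_) fun k hk => ?_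
  · exact (hL k).2 (Finset.mem_Icc.1 hk)
  · have hex : ∃ i, i ≠ j ∧ ℓ i ≠ 1 := by
      by_contra! h
      have hup : Function.update (1 : Fin d → ℕ) j (ℓ j) = ℓ := by
        ext i
        by_cases hi : i = j
        · subst hi
          simp
        · simp [hi, h i hi]
      refine hnot ⟨ℓ j, ?_, hup⟩
      rw [Finset.mem_coe, Finset.mem_Icc, ← hL, hup]
      exact hℓ
    obtain ⟨i, hij, hi⟩ := hex
    rw [tensorRule_coord]
    refine Finset.prod_eq_zero (Finset.mem_univ i) ?_
    rw [if_neg hij, linearCombination_diffRule_one (hW i hij) (hΛ ℓ hℓ i), if_neg hi]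
  · rw [tensorRule_coord, Finset.prod_eq_single j]
    · simp
    · intro i _ hij
      rw [if_neg hij, Function.update_of_ne hij, Pi.one_apply,
        linearCombination_diffRule_one (hW i hij) le_rfl, if_pos rfl]
    · simp

theorem exists_top_level {d : ℕ} {Λ : Finset (Fin d → ℕ)} (hΛ : ∀ ℓ ∈ Λ, ∀ i, 1 ≤ ℓ i)
    {j : Fin d} (hj : ∀ ℓ : ℕ, Function.update (1 : Fin d → ℕ) j ℓ ∈ Λ →
      ∀ k : ℕ, 1 ≤ k → k ≤ ℓ → Function.update (1 : Fin d → ℕ) j k ∈ Λ) :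
    ∃ L, ∀ k, Function.update (1 : Fin d → ℕ) j k ∈ Λ ↔ 1 ≤ k ∧ k ≤ L := by
  set K := (Λ.image fun ℓ => ℓ j).filter fun k => Function.update (1 : Fin d → ℕ) j k ∈ Λ with hK
  have hmem : ∀ k, k ∈ K ↔ Function.update (1 : Fin d → ℕ) j k ∈ Λ := fun k => by
    rw [hK, Finset.mem_filter, and_iff_right_iff_imp]
    exact fun h => Finset.mem_image.2 ⟨_, h, by simp⟩
  have hpos : ∀ k, Function.update (1 : Fin d → ℕ) j k ∈ Λ → 1 ≤ k := fun k hk => by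
    simpa using hΛ _ hk j
  -- If no index of this form lies in `Λ`, the supremum is `0` and the interval is empty.
  refine ⟨K.sup id, fun k => ⟨fun hk => ⟨hpos k hk, Finset.le_sup (f := id) ((hmem k).2 hk)⟩,
    fun ⟨h1, h2⟩ => ?_⟩⟩
  have hne : K.Nonempty := by
    rw [Finset.nonempty_iff_ne_empty]
    intro h
    simp [h] at h2
    omega
  obtain ⟨L, hLK, hLs⟩ := Finset.exists_mem_eq_sup K hne id
  exact hj L ((hmem L).1 hLK) k h1 (by simpa [hLs] using h2)

/-- The number of nodes of the rule of level `L`, and `1` for the zero rule of level `0`. -/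
def levelSize (n : ℕ → ℕ) (L : ℕ) : ℕ :=
  if L = 0 then 1 else n L

theorem levelSize_pos {n : ℕ → ℕ} (hn : ∀ ℓ, 1 ≤ ℓ → 1 ≤ n ℓ) (L : ℕ) : 1 ≤ levelSize n L := by
  unfold levelSize
  split_ifs with h
  · exact le_rfl
  · exact hn L (by omega)

theorem diffNodes_nonempty {n : ℕ → ℕ} (hn : ∀ ℓ, 1 ≤ ℓ → 1 ≤ n ℓ) {ℓ : ℕ} (hℓ : 1 ≤ ℓ) :
    (diffNodes n ℓ).Nonempty := by
  rw [diffNodes, if_neg (by omega)]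
  exact (nodes_nonempty (hn ℓ hℓ)).mono Finset.subset_union_left

/-- The box of the index with `L` in position `j` has the nodes of `Q_L` among its `j`-th
coordinates, and its other sides are nonempty. For `L = 0` a nonempty grid suffices. -/
theorem levelSize_le_card_sparseGrid {d : ℕ} {n : ℕ → ℕ} (hn : ∀ ℓ, 1 ≤ ℓ → 1 ≤ n ℓ)
    {Λ : Finset (Fin d → ℕ)} (hΛ : ∀ ℓ ∈ Λ, ∀ i, 1 ≤ ℓ i) (hne : Λ.Nonempty) {j : Fin d} {L : ℕ}
    (hL : ∀ k, Function.update (1 : Fin d → ℕ) j k ∈ Λ ↔ 1 ≤ k ∧ k ≤ L) :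
    levelSize n L ≤ (sparseGrid n Λ).card := by
  have hbox : ∀ ℓ ∈ Λ, (diffNodes n (ℓ j)).card ≤ (sparseGrid n Λ).card := fun ℓ hℓ => by
    have hsub : Fintype.piFinset (fun i => diffNodes n (ℓ i)) ⊆ sparseGrid n Λ :=
      Finset.subset_biUnion_of_mem (fun ℓ : Fin d → ℕ =>
        Fintype.piFinset fun i => diffNodes n (ℓ i)) hℓ
    refine le_trans ?_ (Finset.card_le_card hsub)
    rw [Fintype.card_piFinset]
    exact Nat.le_of_dvd (Finset.prod_pos fun i _ =>
      Finset.card_pos.2 (diffNodes_nonempty hn (hΛ ℓ hℓ i)))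
      (Finset.dvd_prod_of_mem (fun i => (diffNodes n (ℓ i)).card) (Finset.mem_univ j))
  unfold levelSize
  split_ifs with h
  · obtain ⟨ℓ, hℓ⟩ := hne
    exact (Finset.card_pos.2 (diffNodes_nonempty hn (hΛ ℓ hℓ j))).trans_le (hbox ℓ hℓ)
  · have h1 := hbox _ ((hL L).2 ⟨by omega, le_rfl⟩)
    refine le_trans ?_ h1
    rw [Function.update_self, diffNodes, if_neg h]
    exact (card_nodes (n L)).symm.trans_le (Finset.card_le_card Finset.subset_union_left)

theorem levelSize_le_of_isRuleWithPoints {d : ℕ} {n : ℕ → ℕ} (hn : ∀ ℓ, 1 ≤ ℓ → 1 ≤ n ℓ)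
    {Λ : Finset (Fin d → ℕ)} (hΛ : ∀ ℓ ∈ Λ, ∀ i, 1 ≤ ℓ i) {j : Fin d} {L : ℕ}
    (hL : ∀ k, Function.update (1 : Fin d → ℕ) j k ∈ Λ ↔ 1 ≤ k ∧ k ≤ L) {N : ℕ} (hN : 1 ≤ N)
    (hS : IsRuleWithPoints (sparseGH n Λ) N) : levelSize n L ≤ N := by
  classical
  unfold levelSize
  split_ifs with h
  · exact hN
  obtain ⟨x, w, hxw⟩ := hS
  have hsub : nodes (n L) ⊆ Finset.univ.image fun i => x i j := fun ξ hξ => by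
    by_contra hnot
    -- The identity of functionals holds for all functions, so it may be tested on the indicator of
    -- the hyperplane `y_j = ξ`: one side is the positive weight of `ξ`, the other is zero.
    have h1 := hxw fun y => (Pi.single ξ 1 : ℝ → ℝ) (y j)
    rw [sparseGH, sparseQuad_coord hΛ hL (fun _ _ ℓ hℓ => sum_ghWeight (hn ℓ hℓ)),
      linearCombination_uniRule _ _ _ (by omega), Finset.sum_eq_single_of_mem ξ hξ,
      Finset.sum_eq_zero] at h1
    · simp [(ghWeight_pos hξ).ne'] at h1
    · intro i _
      have : x i j ≠ ξ := fun he => hnot (Finset.mem_image.2 ⟨i, Finset.mem_univ i, he⟩)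
      simp [this]
    · intro η _ hη
      simp [hη]
  calc n L = (nodes (n L)).card := (card_nodes _).symm
    _ ≤ _ := Finset.card_le_card hsub
    _ ≤ _ := Finset.card_image_le
    _ = N := by simp

/-- A smooth profile on which the rule of level `L` fails, whatever its weights are. -/
theorem exists_level_profile (α : ℕ) : ∃ c : ℝ, 0 < c ∧
    ∀ n : ℕ → ℕ, (∀ ℓ, 1 ≤ ℓ → 1 ≤ n ℓ) → ∀ L : ℕ,
      ∃ p : ℝ → ℝ, ContDiff ℝ ∞ p ∧ p ≠ 0 ∧
        (∀ k, MemLp (iteratedDeriv k p) 2 (gaussianReal 0 1)) ∧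
        (∀ W, Finsupp.linearCombination ℝ p (uniRule n W L) = 0) ∧
        c * (levelSize n L : ℝ) ^ (-(α : ℝ) / 2) ≤ |∫ x, p x ∂(gaussianReal 0 1)| /
          √(∑ k : Fin (α + 1), ∫ t, iteratedDeriv k p t ^ 2 ∂(gaussianReal 0 1)) := by
  obtain ⟨c, hc, H⟩ := exists_fooling_profile α
  -- The `1` serves level `0`, where the rule is zero and the constant function `1` has mean and
  -- norm `1`.
  refine ⟨min c 1, lt_min hc one_pos, fun n hn L => ?_⟩
  by_cases hL : L = 0
  · subst hL
    refine ⟨fun _ => 1, contDiff_const, fun h => one_ne_zero (congrFun h 0), fun k => ?_,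
      fun W => linearCombination_uniRule_zero n W _, ?_⟩
    · have : iteratedDeriv k (fun _ : ℝ => (1 : ℝ)) = fun _ => if k = 0 then 1 else 0 :=
        funext fun _ => iteratedDeriv_const
      rw [this]
      exact memLp_const _
    · have hsum : ∑ k : Fin (α + 1), ∫ t, iteratedDeriv k (fun _ : ℝ => (1 : ℝ)) t ^ 2
          ∂(gaussianReal 0 1) = 1 := by
        rw [Finset.sum_eq_single_of_mem 0 (Finset.mem_univ _)]
        · simp
        · intro k _ hk
          simp [iteratedDeriv_const, hk]
      rw [hsum]
      simp [levelSize]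
  · obtain ⟨p, hp, hv, h0, hm, hb⟩ := H (n L) (hn L (by omega))
    refine ⟨p, hp, h0, hm, fun W => ?_, ?_⟩
    · rw [linearCombination_uniRule n W p (by omega)]
      exact Finset.sum_eq_zero fun ξ hξ => by rw [hv ξ hξ, mul_zero]
    · rw [levelSize, if_neg hL]
      exact (mul_le_mul_of_nonneg_right (min_le_left _ _)
        (Real.rpow_nonneg (Nat.cast_nonneg _) _)).trans hb

end GaussHermite

/-! ### The two lower bounds. -/

open GaussHermite
theorem theorem3p1 (α : ℕ) (hα : 1 ≤ α) :
    ∃ c : ℝ, 0 < c ∧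
      ∀ (d : ℕ) (n : ℕ → ℕ), (∀ ℓ, 1 ≤ ℓ → 1 ≤ n ℓ) →
      ∀ Λ : Finset (Fin d → ℕ), (∀ ℓ ∈ Λ, ∀ j, 1 ≤ ℓ j) → DownwardClosedInOneDirection Λ →
        -- the Gauss–Hermite sparse-grid quadrature
        (∀ N : ℕ, 1 ≤ N → IsRuleWithPoints (sparseGH n Λ) N →
          ENNReal.ofReal (c * (N : ℝ) ^ (-(α : ℝ) / 2)) ≤ worstCaseError α (sparseGH n Λ)) ∧
        -- one fooling function, of one variable only, for all choices of the weights
        (Λ.Nonempty →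
          ∃ (j : Fin d) (p : ℝ → ℝ), MemSobolev α (fun x : Fin d → ℝ => p (x j)) ∧ p ≠ 0 ∧
            ∀ W : ℕ → ℝ → ℝ, (d = 1 ∨ ∀ ℓ, 1 ≤ ℓ → ∑ ξ ∈ nodes (n ℓ), W ℓ ξ = 1) →
              c * ((sparseGrid n Λ).card : ℝ) ^ (-(α : ℝ) / 2) ≤
                |gaussInt (fun x : Fin d → ℝ => p (x j)) -
                    sparseQuad n W Λ (fun x => p (x j))| /
                  sobolevNorm α (fun x : Fin d → ℝ => p (x j))) := by
  obtain ⟨c, hc, H⟩ := exists_level_profile α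
  refine ⟨c, hc, fun d n hn Λ hΛ ⟨j, hj⟩ => ?_⟩
  obtain ⟨L, hL⟩ := exists_top_level hΛ hj
  obtain ⟨p, hp, hp0, hmem, hzero, hbound⟩ := H n hn L
  have hSob : MemSobolev α fun x : Fin d → ℝ => p (x j) :=
    memSobolev_coord α j hp fun k _ => hmem k
  have hsize : (0 : ℝ) < levelSize n L := by exact_mod_cast levelSize_pos hn L
  -- Both claims are instances of this bound. As the exponent is nonpositive, `levelSize n L` may be
  -- replaced by any larger count `N`.
  have key : ∀ W : ℕ → ℝ → ℝ,
      (∀ i : Fin d, i ≠ j → ∀ ℓ, 1 ≤ ℓ → ∑ ξ ∈ nodes (n ℓ), W ℓ ξ = 1) →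
      ∀ N : ℕ, levelSize n L ≤ N → c * (N : ℝ) ^ (-(α : ℝ) / 2) ≤
        |gaussInt (fun x : Fin d → ℝ => p (x j)) - sparseQuad n W Λ (fun x => p (x j))| /
          sobolevNorm α (fun x : Fin d → ℝ => p (x j)) := fun W hW N hN => by
    rw [sparseQuad_coord hΛ hL hW, hzero W, sub_zero, gaussInt,
      integral_coord j hp.continuous, sobolevNorm_coord α j hp]
    refine (mul_le_mul_of_nonneg_left ?_ hc.le).trans hbound
    refine Real.rpow_le_rpow_of_nonpos hsize (by exact_mod_cast hN) ?_
    have : (0 : ℝ) ≤ α := Nat.cast_nonneg α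
    linarith
  refine ⟨fun N hN hS => ?_, fun hne => ⟨j, p, hSob, hp0, fun W hW => ?_⟩⟩
  · have hh0 : (fun x : Fin d → ℝ => p (x j)) ≠ 0 := fun h =>
      hp0 (funext fun t => congrFun h fun _ => t)
    refine le_iSup_of_le ⟨fun x : Fin d → ℝ => p (x j), hSob, hh0⟩ (ENNReal.ofReal_le_ofReal ?_)
    exact key _ (fun _ _ ℓ hℓ => sum_ghWeight (hn ℓ hℓ)) N
      (levelSize_le_of_isRuleWithPoints hn hΛ hL hN hS)
  · refine key W (fun i hi => ?_) _ (levelSize_le_card_sparseGrid hn hΛ hne hL)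
    rcases hW with rfl | hW
    · exact absurd (Subsingleton.elim i j) hi
    · exact hW
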